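/- Fix countably infinite sets of concept names and of role names, a countably infinite domain $\Delta$, and an infinite set of constants which are standard names: distinct constants denote distinct elements of $\Delta$, the same ones in every interpretation. All interpretations have domain $\Delta$, and an interpretation is also viewed as a set of atoms $A(d)$, $P(d,e)$. With basic roles $R ::= P \mid P^-$ and basic concepts $B ::= A \mid \exists R$, a DL-Lite$_{core}$ TBox consists of finitely many axioms $B_1\sqsubseteq B_2$, $B_1\sqsubseteq\neg B_2$; DL-Lite$_{\mathcal F}$ adds functionality axioms $(\mathrm{funct}\ R)$; DL-Lite$_{\mathcal{FR}}$ adds in addition role inclusions $R_1\sqsubseteq R_2$, $R_1\sqsubseteq\neg R_2$, where $R_1\sqsubseteq R_2$ may not occur together with $(\mathrm{funct}\ R_2)$ or $(\mathrm{funct}\ R_2^-)$. An ABox is a finite set of membership assertions; these are $A(a)$ and $P(a,b)$ in DL-Lite$_{core}$ and DL-Lite$_{\mathcal F}$, while DL-Lite$_{\mathcal{FR}}$ also admits $\exists R(a)$. A KB $\mathcal K=\mathcal T\cup\mathcal A$ is a TBox with an ABox. Let $\mathcal N$ be an ABox, the new information. The distance of two interpretations $\mathcal I,\mathcal J$ is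 either atom-based ($a$), the symmetric difference $\mathcal I\ominus\mathcal J$ of their sets of atoms, or symbol-based ($s$), the set of names that $\mathcal I$ and $\mathcal J$ interpret differently (among all names, or among a prescribed set of names that contains those of $\mathcal K\cup\mathcal N$). Distances are compared by set inclusion ($\subseteq$) or by cardinality ($\#$). The ABox expansion of $\mathcal K=\mathcal T\cup\mathcal A$ with $\mathcal N$ is the following set of interpretations: under the local semantics $\mathbf L^y_z$, with $y\in\{a,s\}$ and $z\in\{\subseteq,\#\}$, all $\mathcal J\in\mathrm{Mod}(\mathcal T\cup\mathcal N)$ for which some $\mathcal I\in\mathrm{Mod}(\mathcal K)$ exists such that no $\mathcal J'\in\mathrm{Mod}(\mathcal T\cup\mathcal N)$ has strictly smaller distance to $\mathcal I$; under the global semantics $\mathbf G^y_z$, all $\mathcal J\in\mathrm{Mod}(\mathcal T\cup\mathcal N)$ for which some $\mathcal I\in\mathrm{Mod}(\mathcal K)$ exists such that no pair $(\mathcal I',\mathcal J')\in\mathrm{Mod}(\mathcal K)\times\mathrm{Mod}(\mathcal T\cup\mathcal N)$ has a strictly smaller distance than $(\mathcal I,\mathcal J)$. A DL is closed under ABox expansion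 for a semantics if for every KB $\mathcal K=\mathcal T\cup\mathcal A$ of the DL and every ABox $\mathcal N$ with $\mathcal K$ and $\mathcal T\cup\mathcal N$ satisfiable, the expansion is $\mathrm{Mod}(\mathcal K')$ for some KB $\mathcal K'$ of the DL. **Theorem.** DL-Lite$_{\mathcal{FR}}$ is not closed under ABox expansion for $\mathbf G^a_\subseteq$ and for $\mathbf L^y_z$, where $y\in\{a,s\}$ and $z\in\{\subseteq,\#\}$. Moreover, for each of the four local semantics there is already a satisfiable initial KB in DL-Lite$_{core}$, and for $\mathbf G^a_\subseteq$ one in DL-Lite$_{\mathcal F}$, whose expansion with a single membership assertion ($A(a)$ or $P(a,b)$, consistent with the TBox) is not the set of models of any DL-Lite$_{\mathcal{FR}}$ KB, even if the restriction on the joint use of role inclusions and functionality is dropped. In all five cases the KB and the assertion can be chosen such that, in addition, for some concept name $A$ and constants $a,b$ every interpretation in the expansion satisfies $A(a)$ or $A(b)$, but neither $A(a)$ nor $A(b)$ holds in all of them. -/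

import Mathlib

namespace DLLite

universe u v w x

/-- Basic roles `R ::= P | P⁻`, over the role names `NR`. -/
inductive Role (NR : Type v) : Type v
  | atom (P : NR)
  | inv (P : NR)

/-- The inverse of a basic role, with `(P⁻)⁻ = P`. -/
def Role.inverse {NR : Type v} : Role NR → Role NR
  | .atom P => .inv P
  | .inv P => .atom P

/-- Basic concepts `B ::= A | ∃R`, over the concept names `NC` and the role names `NR`. -/
inductive Basic (NC : Type u) (NR : Type v) : Type (max u v)
  | atom (A : NC)
  | ex (R : Role NR)

/-- TBox axioms: `B₁ ⊑ B₂`, `B₁ ⊑ ¬B₂`, `R₁ ⊑ R₂`, `R₁ ⊑ ¬R₂` and `(funct R)`. -/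
inductive Axm (NC : Type u) (NR : Type v) : Type (max u v)
  | conceptIncl (B₁ B₂ : Basic NC NR)
  | conceptDisj (B₁ B₂ : Basic NC NR)
  | roleIncl (R₁ R₂ : Role NR)
  | roleDisj (R₁ R₂ : Role NR)
  | funct (R : Role NR)

/-- ABox axioms (membership assertions) `B(a)` and `P(a, b)`, over the constants `C`. -/
inductive Assertion (NC : Type u) (NR : Type v) (C : Type w) : Type (max u v w)
  | concept (B : Basic NC NR) (a : C)
  | role (P : NR) (a b : C)

/-- A knowledge base: a finite TBox together with a finite ABox. -/
structure KB (NC : Type u) (NR : Type v) (C : Type w) where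
  tbox : Finset (Axm NC NR)
  abox : Finset (Assertion NC NR C)

/-! ### The languages -/

/-- The assertion is of the form `A(a)` with `A` a concept name, or `P(a, b)`. -/
def Assertion.IsAtomic {NC : Type u} {NR : Type v} {C : Type w} : Assertion NC NR C → Prop
  | .concept (.atom _) _ => True
  | .concept (.ex _) _ => False
  | .role _ _ _ => True

/-- The axiom is a concept inclusion `B₁ ⊑ B₂` or `B₁ ⊑ ¬B₂`. -/
def Axm.IsConceptInclusion {NC : Type u} {NR : Type v} : Axm NC NR → Prop
  | .conceptIncl _ _ => True
  | .conceptDisj _ _ => True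
  | _ => False

/-- The axiom is a functionality assertion. -/
def Axm.IsFunctionality {NC : Type u} {NR : Type v} : Axm NC NR → Prop
  | .funct _ => True
  | _ => False

/-- Knowledge bases in `DL-Lite_core`. -/
def KB.IsCore {NC : Type u} {NR : Type v} {C : Type w} (K : KB NC NR C) : Prop :=
  (∀ τ ∈ K.tbox, τ.IsConceptInclusion) ∧ ∀ α ∈ K.abox, α.IsAtomic

/-- Knowledge bases in `DL-Lite_F`. -/
def KB.IsF {NC : Type u} {NR : Type v} {C : Type w} (K : KB NC NR C) : Prop :=
  (∀ τ ∈ K.tbox, τ.IsConceptInclusion ∨ τ.IsFunctionality) ∧ ∀ α ∈ K.abox, α.IsAtomic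

/-- Knowledge bases in `DL-Lite_FR`: all forms of axioms, under the usual proviso that a
functional role, or a role with a functional inverse, has no other role included in it. -/
def KB.IsFR {NC : Type u} {NR : Type v} {C : Type w} (K : KB NC NR C) : Prop :=
  ∀ R₁ R₂ : Role NR, Axm.roleIncl R₁ R₂ ∈ K.tbox →
    Axm.funct R₂ ∉ K.tbox ∧ Axm.funct R₂.inverse ∉ K.tbox

/-! ### Symbols that occur in a knowledge base -/

/-- A symbol is a concept name or a role name. -/
abbrev Symb (NC : Type u) (NR : Type v) : Type (max u v) := NC ⊕ NR

def Role.symb {NR : Type v} (NC : Type u) : Role NR → Symb NC NR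
  | .atom P => Sum.inr P
  | .inv P => Sum.inr P

def Basic.symb {NC : Type u} {NR : Type v} : Basic NC NR → Symb NC NR
  | .atom A => Sum.inl A
  | .ex R => R.symb NC

def Axm.symbols {NC : Type u} {NR : Type v} : Axm NC NR → Set (Symb NC NR)
  | .conceptIncl B₁ B₂ => {B₁.symb, B₂.symb}
  | .conceptDisj B₁ B₂ => {B₁.symb, B₂.symb}
  | .roleIncl R₁ R₂ => {R₁.symb NC, R₂.symb NC}
  | .roleDisj R₁ R₂ => {R₁.symb NC, R₂.symb NC}
  | .funct R => {R.symb NC}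

def Assertion.symbols {NC : Type u} {NR : Type v} {C : Type w} :
    Assertion NC NR C → Set (Symb NC NR)
  | .concept B _ => {B.symb}
  | .role P _ _ => {Sum.inr P}

/-- The symbols that occur in `K ∪ N`. -/
def symbolsIn {NC : Type u} {NR : Type v} {C : Type w} (K : KB NC NR C)
    (N : Finset (Assertion NC NR C)) : Set (Symb NC NR) :=
  {s | (∃ τ ∈ K.tbox, s ∈ τ.symbols) ∨ (∃ α ∈ K.abox, s ∈ α.symbols) ∨
    ∃ α ∈ N, s ∈ α.symbols}

/-! ### Interpretations and models -/

/-- Interpretations over the fixed domain `D`. -/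
structure Interp (NC : Type u) (NR : Type v) (D : Type x) where
  conc : NC → Set D
  role : NR → Set (D × D)

def Interp.roleExt {NC : Type u} {NR : Type v} {D : Type x} (I : Interp NC NR D) :
    Role NR → Set (D × D)
  | .atom P => I.role P
  | .inv P => {p | (p.2, p.1) ∈ I.role P}

def Interp.basicExt {NC : Type u} {NR : Type v} {D : Type x} (I : Interp NC NR D) :
    Basic NC NR → Set D
  | .atom A => I.conc A
  | .ex R => {d | ∃ e, (d, e) ∈ I.roleExt R}

def Interp.SatAxm {NC : Type u} {NR : Type v} {D : Type x} (I : Interp NC NR D) :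
    Axm NC NR → Prop
  | .conceptIncl B₁ B₂ => I.basicExt B₁ ⊆ I.basicExt B₂
  | .conceptDisj B₁ B₂ => I.basicExt B₁ ⊆ (I.basicExt B₂)ᶜ
  | .roleIncl R₁ R₂ => I.roleExt R₁ ⊆ I.roleExt R₂
  | .roleDisj R₁ R₂ => I.roleExt R₁ ⊆ (I.roleExt R₂)ᶜ
  | .funct R => ∀ d e e', (d, e) ∈ I.roleExt R → (d, e') ∈ I.roleExt R → e = e'

/-- Satisfaction of membership assertions. Constants are standard names: every interpretation
interprets the constant `a` as the domain element `name a`. -/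
def Interp.SatAssertion {NC : Type u} {NR : Type v} {C : Type w} {D : Type x} (name : C ↪ D)
    (I : Interp NC NR D) : Assertion NC NR C → Prop
  | .concept B a => name a ∈ I.basicExt B
  | .role P a b => (name a, name b) ∈ I.role P

/-- `Mod(K)`. -/
def models {NC : Type u} {NR : Type v} {C : Type w} {D : Type x} (name : C ↪ D)
    (K : KB NC NR C) : Set (Interp NC NR D) :=
  {I | (∀ τ ∈ K.tbox, I.SatAxm τ) ∧ ∀ α ∈ K.abox, I.SatAssertion name α}

/-! ### Distances between interpretations -/

/-- Atoms `A(d)` and `P(d, e)` over the domain. -/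
inductive Atom (NC : Type u) (NR : Type v) (D : Type x) : Type (max u v x)
  | concept (A : NC) (d : D)
  | role (P : NR) (d e : D)

/-- An interpretation, viewed as a set of atoms. -/
def Interp.atoms {NC : Type u} {NR : Type v} {D : Type x} (I : Interp NC NR D) :
    Set (Atom NC NR D) :=
  {t | match t with
    | .concept A d => d ∈ I.conc A
    | .role P d e => (d, e) ∈ I.role P}

/-- The atom-based difference `I ⊖ J`. -/
def atomDiff {NC : Type u} {NR : Type v} {D : Type x} (I J : Interp NC NR D) :
    Set (Atom NC NR D) :=
  symmDiff I.atoms J.atoms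

/-- The symbol-based difference: the symbols of `S` that `I` and `J` interpret differently. -/
def symbolDiff {NC : Type u} {NR : Type v} {D : Type x} (S : Set (Symb NC NR))
    (I J : Interp NC NR D) : Set (Symb NC NR) :=
  {s | s ∈ S ∧ match s with
    | .inl A => I.conc A ≠ J.conc A
    | .inr P => I.role P ≠ J.role P}

/-- Atom-based (`a`) or symbol-based (`s`) distances. -/
inductive Granularity : Type
  | atomBased
  | symbolBased

/-- Distances compared by set inclusion (`⊆`) or by cardinality (`#`). -/
inductive Comparison : Type
  | inclusion
  | cardinality

/-- `dist(I, J)` is strictly smaller than `dist(I', J')`. -/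
def DistLT {NC : Type u} {NR : Type v} {D : Type x} (S : Set (Symb NC NR)) :
    Granularity → Comparison → (I J I' J' : Interp NC NR D) → Prop
  | .atomBased, .inclusion, I, J, I', J' => atomDiff I J ⊂ atomDiff I' J'
  | .atomBased, .cardinality, I, J, I', J' => (atomDiff I J).encard < (atomDiff I' J').encard
  | .symbolBased, .inclusion, I, J, I', J' => symbolDiff S I J ⊂ symbolDiff S I' J'
  | .symbolBased, .cardinality, I, J, I', J' =>
      (symbolDiff S I J).encard < (symbolDiff S I' J').encard

/-! ### ABox expansion -/

/-- The model-based semantics: global or local, with a choice of distance. -/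
inductive Sem : Type
  | glob (y : Granularity) (z : Comparison)
  | loc (y : Granularity) (z : Comparison)

/-- The set of interpretations that results from the ABox expansion of `K = T ∪ A` with the
ABox `N`; the TBox `T` is retained, so that the candidates are the models of `T ∪ N`.
Local: those at minimal distance from some given model of `K`.
Global: those that belong to a pair of minimal distance among all pairs of a model of `K` and a
model of `T ∪ N`. The symbol-based distances look at the symbols in `S`. -/
def expansion {NC : Type u} {NR : Type v} {C : Type w} {D : Type x} (name : C ↪ D)
    (S : Set (Symb NC NR)) (K : KB NC NR C) (N : Finset (Assertion NC NR C)) :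
    Sem → Set (Interp NC NR D)
  | .loc y z => {J | J ∈ models name ⟨K.tbox, N⟩ ∧ ∃ I ∈ models name K,
      ∀ J' ∈ models name ⟨K.tbox, N⟩, ¬ DistLT S y z I J' I J}
  | .glob y z => {J | J ∈ models name ⟨K.tbox, N⟩ ∧ ∃ I ∈ models name K,
      ∀ I' ∈ models name K, ∀ J' ∈ models name ⟨K.tbox, N⟩, ¬ DistLT S y z I' J' I J}

/-- `DL-Lite_FR` is closed under ABox expansion for the semantics `s`. Here `sig K N` is the set of
symbols at which the symbol-based distances look. -/
def ClosedUnderABoxExpansion {NC : Type u} {NR : Type v} {C : Type w} {D : Type x} (name : C ↪ D)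
    (sig : KB NC NR C → Finset (Assertion NC NR C) → Set (Symb NC NR)) (s : Sem) : Prop :=
  ∀ (K : KB NC NR C) (N : Finset (Assertion NC NR C)), K.IsFR →
    (models name K).Nonempty → (models name ⟨K.tbox, N⟩).Nonempty →
    ∃ K' : KB NC NR C, K'.IsFR ∧ models name K' = expansion name (sig K N) K N s

/-- There are a satisfiable knowledge base `K` in the language `L` and a single atomic membership
assertion `α`, consistent with the TBox of `K`, such that the expansion of `K` with `α` is the set
of models of no knowledge base at all (whether or not it obeys the proviso of `DL-Lite_FR`).
Moreover, for some concept name `A` and constants `a`, `b`, all interpretations in the expansion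
satisfy `A(a)` or `A(b)`, but not all satisfy `A(a)` and not all satisfy `A(b)`. -/
def InexpressibleABoxExpansionFrom {NC : Type u} {NR : Type v} {C : Type w} {D : Type x}
    (name : C ↪ D) (sig : KB NC NR C → Finset (Assertion NC NR C) → Set (Symb NC NR))
    (L : KB NC NR C → Prop) (s : Sem) : Prop :=
  ∃ (K : KB NC NR C) (α : Assertion NC NR C), L K ∧ α.IsAtomic ∧
    (models name K).Nonempty ∧ (models name ⟨K.tbox, {α}⟩).Nonempty ∧
    (¬ ∃ K' : KB NC NR C, models name K' = expansion name (sig K {α}) K {α} s) ∧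
    ∃ (A : NC) (a b : C),
      (∀ J ∈ expansion name (sig K {α}) K {α} s,
        J.SatAssertion name (.concept (.atom A) a) ∨
          J.SatAssertion name (.concept (.atom A) b)) ∧
      (∃ J ∈ expansion name (sig K {α}) K {α} s,
        ¬ J.SatAssertion name (.concept (.atom A) a)) ∧
      ∃ J ∈ expansion name (sig K {α}) K {α} s,
        ¬ J.SatAssertion name (.concept (.atom A) b)

end DLLite

/-!
All axioms and assertions of these description logics are Horn, so the models of a knowledge base
are closed under direct products. As only finitely many constants occur in a knowledge base, a
bijection of the domain with its square that sends these constants to the diagonal turns the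
product of two models into a model over the original domain (`prodInterp_mem_models`). Hence a
knowledge base that entails `A(a) ∨ A(b)` entails one of the disjuncts (`models_convex`), and it is
enough to find expansions that entail such a disjunction but neither disjunct.

For the local semantics, let `T` consist of `E ⊑ ∃R`, `∃R⁻ ⊑ ¬A`, `B ⊑ A`, `C ⊑ A` and `B ⊑ ¬C`,
let the initial ABox be `B(b)`, `C(a)`, and let `E(w)` be the new assertion. A model of `T` and
`E(w)` has an `R`-edge from `w` to some `x` outside of `A`. The change from a model `I` of `T` that
adds `E(w)` and `R(w, x)` and takes `x` out of `A`, `B` and `C` (`repair`) is at most as large as any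
other one that yields this edge, for each of the four distances. It takes out of `A` only the
element `x`, and it alters at most one of `B` and `C`, since these are disjoint. In either case
`A(a)` or `A(b)` survives. If `A` is the whole domain and `B`, `C` partition it, then all repairs
have distance four, none is better than another, and those at `a` and at `b` refute the single
disjuncts.

For the global semantics, let `T` consist of `B ⊑ ∃R`, `∃R⁻ ⊑ ¬A` and `(funct R)`, let the initial
ABox be `R(w, c)`, `B(w)`, `A(a)`, `A(b)`, and let `A(c)` be the new assertion. The edge `R(w, c)`
is lost; then either `B(w)` is given up, or `w` receives a new successor, which by functionality
was no successor in any model of the initial knowledge base. A minimal pair thus takes at most one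
of `a`, `b` out of `A`, and it may take out either of them.
-/

namespace DLLite

universe u v w x

variable {NC : Type u} {NR : Type v} {C : Type w} {D : Type x}

/-! ### Products of models -/

/-- The direct product of two interpretations, transported to the domain `D` along a bijection of
`D` with `D × D`. -/
def prodInterp (f : D ≃ D × D) (I J : Interp NC NR D) : Interp NC NR D where
  conc A := {d | (f d).1 ∈ I.conc A ∧ (f d).2 ∈ J.conc A}
  role P := {p | ((f p.1).1, (f p.2).1) ∈ I.role P ∧ ((f p.1).2, (f p.2).2) ∈ J.role P}

theorem mem_roleExt_prodInterp (f : D ≃ D × D) (I J : Interp NC NR D) (R : Role NR) (d e : D) :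
    (d, e) ∈ (prodInterp f I J).roleExt R ↔
      ((f d).1, (f e).1) ∈ I.roleExt R ∧ ((f d).2, (f e).2) ∈ J.roleExt R := by
  cases R <;> rfl

theorem mem_basicExt_prodInterp (f : D ≃ D × D) (I J : Interp NC NR D) (B : Basic NC NR) (d : D) :
    d ∈ (prodInterp f I J).basicExt B ↔ (f d).1 ∈ I.basicExt B ∧ (f d).2 ∈ J.basicExt B := by
  cases B with
  | atom A => rfl
  | ex R =>
    constructor
    · rintro ⟨e, he⟩
      rw [mem_roleExt_prodInterp] at he
      exact ⟨⟨_, he.1⟩, ⟨_, he.2⟩⟩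
    · rintro ⟨⟨e₁, h₁⟩, ⟨e₂, h₂⟩⟩
      refine ⟨f.symm (e₁, e₂), ?_⟩
      rw [mem_roleExt_prodInterp]
      simpa using ⟨h₁, h₂⟩

theorem satAxm_prodInterp (f : D ≃ D × D) {I J : Interp NC NR D} {τ : Axm NC NR}
    (hI : I.SatAxm τ) (hJ : J.SatAxm τ) : (prodInterp f I J).SatAxm τ := by
  cases τ with
  | conceptIncl B₁ B₂ =>
    intro d hd
    rw [mem_basicExt_prodInterp] at hd ⊢
    exact ⟨hI hd.1, hJ hd.2⟩
  | conceptDisj B₁ B₂ =>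
    intro d hd hd'
    rw [mem_basicExt_prodInterp] at hd hd'
    exact hI hd.1 hd'.1
  | roleIncl R₁ R₂ =>
    rintro ⟨d, e⟩ hd
    rw [mem_roleExt_prodInterp] at hd ⊢
    exact ⟨hI hd.1, hJ hd.2⟩
  | roleDisj R₁ R₂ =>
    rintro ⟨d, e⟩ hd hd'
    rw [mem_roleExt_prodInterp] at hd hd'
    exact hI hd.1 hd'.1
  | funct R =>
    intro d e e' he he'
    rw [mem_roleExt_prodInterp] at he he'
    exact f.injective (Prod.ext (hI _ _ _ he.1 he'.1) (hJ _ _ _ he.2 he'.2))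

/-- The constants that occur in an assertion. -/
def Assertion.constants : Assertion NC NR C → Set C
  | .concept _ a => {a}
  | .role _ a b => {a, b}

theorem Assertion.finite_constants (α : Assertion NC NR C) : α.constants.Finite := by
  cases α <;> simp [Assertion.constants]

theorem satAssertion_prodInterp {name : C ↪ D} {f : D ≃ D × D} {I J : Interp NC NR D}
    {α : Assertion NC NR C} (hf : ∀ c ∈ α.constants, f (name c) = (name c, name c)) :
    (prodInterp f I J).SatAssertion name α ↔
      I.SatAssertion name α ∧ J.SatAssertion name α := by
  cases α with
  | concept B a =>
    have ha := hf a rfl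
    simp only [Interp.SatAssertion, mem_basicExt_prodInterp, ha]
  | role P a b =>
    have ha := hf a (Or.inl rfl)
    have hb := hf b (Or.inr rfl)
    simp only [Interp.SatAssertion, prodInterp, Set.mem_ofPred_eq, ha, hb]

theorem prodInterp_mem_models {name : C ↪ D} {f : D ≃ D × D} {I J : Interp NC NR D}
    {K : KB NC NR C}
    (hf : ∀ α ∈ K.abox, ∀ c ∈ α.constants, f (name c) = (name c, name c))
    (hI : I ∈ models name K) (hJ : J ∈ models name K) : prodInterp f I J ∈ models name K :=
  ⟨fun τ hτ => satAxm_prodInterp f (hI.1 τ hτ) (hJ.1 τ hτ),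
    fun α hα => (satAssertion_prodInterp (hf α hα)).2 ⟨hI.2 α hα, hJ.2 α hα⟩⟩

theorem exists_equiv_prod_diag [Countable D] [Infinite D] {s : Set D} (hs : s.Finite) :
    ∃ f : D ≃ D × D, ∀ d ∈ s, f d = (d, d) := by
  obtain ⟨f, hf⟩ := Cardinal.extend_function_of_lt (s := s)
    ⟨fun d : s => ((d : D), (d : D)), fun d e h => Subtype.ext (congrArg Prod.fst h)⟩
    ((Cardinal.lt_aleph0_iff_set_finite.2 hs).trans_le (Cardinal.aleph0_le_mk D))
    (nonempty_equiv_of_countable (α := D) (β := D × D))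
  exact ⟨f, fun d hd => hf ⟨d, hd⟩⟩

/-- Knowledge bases are convex: an entailed disjunction of two assertions has an entailed
disjunct. -/
theorem models_convex [Countable D] [Infinite D] (name : C ↪ D) (K : KB NC NR C)
    (α β : Assertion NC NR C)
    (h : ∀ J ∈ models name K, J.SatAssertion name α ∨ J.SatAssertion name β) :
    (∀ J ∈ models name K, J.SatAssertion name α) ∨
      ∀ J ∈ models name K, J.SatAssertion name β := by
  by_contra! hne
  obtain ⟨⟨I, hI, hIα⟩, ⟨J, hJ, hJβ⟩⟩ := hne
  obtain ⟨f, hf⟩ := exists_equiv_prod_diag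
    (s := name '' ((⋃ γ ∈ K.abox, γ.constants) ∪ (α.constants ∪ β.constants)))
    (((K.abox.finite_toSet.biUnion fun γ _ => γ.finite_constants).union
      (α.finite_constants.union β.finite_constants)).image _)
  have hfK : ∀ γ ∈ K.abox, ∀ c ∈ γ.constants, f (name c) = (name c, name c) :=
    fun γ hγ c hc => hf _ ⟨c, Or.inl (Set.mem_biUnion hγ hc), rfl⟩
  rcases h _ (prodInterp_mem_models hfK hI hJ) with h | h
  · exact hIα ((satAssertion_prodInterp
      fun c hc => hf _ ⟨c, Or.inr (Or.inl hc), rfl⟩).1 h).1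
  · exact hJβ ((satAssertion_prodInterp
      fun c hc => hf _ ⟨c, Or.inr (Or.inr hc), rfl⟩).1 h).2

/-- A set of interpretations that entails `A(a) ∨ A(b)`, but neither disjunct, is the set of models
of no knowledge base. -/
theorem not_exists_models_eq [Countable D] [Infinite D] (name : C ↪ D)
    {M : Set (Interp NC NR D)} {α β : Assertion NC NR C}
    (h : ∀ J ∈ M, J.SatAssertion name α ∨ J.SatAssertion name β)
    (hα : ∃ J ∈ M, ¬ J.SatAssertion name α) (hβ : ∃ J ∈ M, ¬ J.SatAssertion name β) :
    ¬ ∃ K : KB NC NR C, models name K = M := by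
  rintro ⟨K, rfl⟩
  obtain ⟨I, hI, hIα⟩ := hα
  obtain ⟨J, hJ, hJβ⟩ := hβ
  rcases models_convex name K α β h with h | h
  · exact hIα (h I hI)
  · exact hJβ (h J hJ)

theorem InexpressibleABoxExpansionFrom.not_closed {name : C ↪ D}
    {sig : KB NC NR C → Finset (Assertion NC NR C) → Set (Symb NC NR)}
    {L : KB NC NR C → Prop} {s : Sem} (h : InexpressibleABoxExpansionFrom name sig L s)
    (hL : ∀ K, L K → K.IsFR) : ¬ ClosedUnderABoxExpansion name sig s := by
  obtain ⟨K, α, hK, -, hsat, hsat', hne, -⟩ := h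
  intro hcl
  obtain ⟨K', -, hK'⟩ := hcl K {α} (hL K hK) hsat hsat'
  exact hne ⟨K', hK'⟩

theorem KB.IsF.isFR {K : KB NC NR C} (h : K.IsF) : K.IsFR := by
  intro R₁ R₂ hR
  simpa [Axm.IsConceptInclusion, Axm.IsFunctionality] using h.1 _ hR

theorem KB.IsCore.isF {K : KB NC NR C} (h : K.IsCore) : K.IsF :=
  ⟨fun τ hτ => Or.inl (h.1 τ hτ), h.2⟩

/-! ### Comparison of differences -/

@[simp]
theorem concept_mem_atomDiff {I J : Interp NC NR D} {X : NC} {d : D} :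
    Atom.concept X d ∈ atomDiff I J ↔ ¬ (d ∈ I.conc X ↔ d ∈ J.conc X) := by
  simp only [atomDiff, Set.mem_symmDiff, Interp.atoms, Set.mem_ofPred_eq]
  tauto

@[simp]
theorem role_mem_atomDiff {I J : Interp NC NR D} {P : NR} {d e : D} :
    Atom.role P d e ∈ atomDiff I J ↔ ¬ ((d, e) ∈ I.role P ↔ (d, e) ∈ J.role P) := by
  simp only [atomDiff, Set.mem_symmDiff, Interp.atoms, Set.mem_ofPred_eq]
  tauto

theorem encard_insert_four {α : Type*} {p q r s : α} (h : [p, q, r, s].Nodup) :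
    ({p, q, r, s} : Set α).encard = 4 := by
  simp only [List.nodup_cons, List.mem_cons, List.not_mem_nil, not_or, or_false] at h
  rw [Set.encard_insert_of_notMem (by simp; tauto), Set.encard_insert_of_notMem (by simp; tauto),
    Set.encard_insert_of_notMem (by simp; tauto), Set.encard_singleton]
  norm_num

theorem encard_insert_four_le {α : Type*} (p q r s : α) :
    ({p, q, r, s} : Set α).encard ≤ 4 := by
  refine (Set.encard_insert_le _ _).trans ?_
  refine (add_le_add_left ((Set.encard_insert_le _ _).trans
    (add_le_add_left (Set.encard_insert_le _ _) 1)) 1).trans ?_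
  rw [Set.encard_singleton]
  norm_num

/-- The difference of two interpretations in the given granularity, as a set of atoms or of symbols
of `S`. It lives in the sum of the two types, so that both granularities can be treated at once. -/
def diff (S : Set (Symb NC NR)) (y : Granularity) (I J : Interp NC NR D) :
    Set (Atom NC NR D ⊕ Symb NC NR) :=
  match y with
  | .atomBased => Sum.inl '' atomDiff I J
  | .symbolBased => Sum.inr '' symbolDiff S I J

theorem distLT_inclusion {S : Set (Symb NC NR)} {y : Granularity} {I J I' J' : Interp NC NR D} :
    DistLT S y .inclusion I J I' J' ↔ diff S y I J ⊂ diff S y I' J' := by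
  cases y
  · simp only [DistLT, diff, Set.ssubset_def, Set.image_subset_image_iff Sum.inl_injective]
  · simp only [DistLT, diff, Set.ssubset_def, Set.image_subset_image_iff Sum.inr_injective]

theorem distLT_cardinality {S : Set (Symb NC NR)} {y : Granularity} {I J I' J' : Interp NC NR D} :
    DistLT S y .cardinality I J I' J' ↔ (diff S y I J).encard < (diff S y I' J').encard := by
  cases y
  · simp only [DistLT, diff, Sum.inl_injective.encard_image]
  · simp only [DistLT, diff, Sum.inr_injective.encard_image]

/-- Both comparisons detect that a finite difference is properly contained in another one. -/
theorem diff_eq_of_not_distLT {S : Set (Symb NC NR)} {y : Granularity} {z : Comparison}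
    {I J I' J' : Interp NC NR D} (hfin : (diff S y I J).Finite)
    (hsub : diff S y I J ⊆ diff S y I' J') (h : ¬ DistLT S y z I J I' J') :
    diff S y I J = diff S y I' J' := by
  by_contra hne
  have hss : diff S y I J ⊂ diff S y I' J' := hsub.ssubset_of_ne hne
  cases z
  · exact h (distLT_inclusion.2 hss)
  · exact h (distLT_cardinality.2 (hfin.encard_lt_encard hss))

theorem not_distLT_of_encard_le {S : Set (Symb NC NR)} {y : Granularity} {z : Comparison}
    {I J I' J' : Interp NC NR D} {n : ℕ} (hle : (diff S y I' J').encard ≤ n)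
    (hge : n ≤ (diff S y I J).encard) : ¬ DistLT S y z I J I' J' := by
  cases z
  · rw [distLT_inclusion]
    intro hss
    have hfin : (diff S y I' J').Finite := Set.finite_of_encard_le_coe hle
    exact (((hfin.subset hss.subset).encard_lt_encard hss).trans_le hle).not_ge hge
  · rw [distLT_cardinality]
    exact not_lt.2 (hle.trans hge)

/-! ### Local semantics -/

/-- The concept names used for the local semantics. -/
inductive LocalName : Type
  | E | A | B | C

theorem nonempty_localName_embedding (NC : Type u) [Infinite NC] : Nonempty (LocalName ↪ NC) :=
  ⟨.trans ⟨fun | .E => 0 | .A => 1 | .B => 2 | .C => 3, by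
    intro X Y h
    cases X <;> cases Y <;> first | rfl | simp at h⟩ (Infinite.natEmbedding NC)⟩

open Classical in
/-- The TBox `E ⊑ ∃R`, `∃R⁻ ⊑ ¬A`, `B ⊑ A`, `C ⊑ A`, `B ⊑ ¬C`. -/
noncomputable def localTBox (ν : LocalName ↪ NC) (R : NR) : Finset (Axm NC NR) :=
  {.conceptIncl (.atom (ν .E)) (.ex (.atom R)), .conceptDisj (.ex (.inv R)) (.atom (ν .A)),
    .conceptIncl (.atom (ν .B)) (.atom (ν .A)), .conceptIncl (.atom (ν .C)) (.atom (ν .A)),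
    .conceptDisj (.atom (ν .B)) (.atom (ν .C))}

open Classical in
/-- The knowledge base with the TBox `localTBox` and the ABox `B(b)`, `C(a)`. -/
noncomputable def localKB (ν : LocalName ↪ NC) (R : NR) (a b : C) : KB NC NR C where
  tbox := localTBox ν R
  abox := {.concept (.atom (ν .B)) b, .concept (.atom (ν .C)) a}

theorem isCore_localKB (ν : LocalName ↪ NC) (R : NR) (a b : C) : (localKB ν R a b).IsCore := by
  simp [KB.IsCore, localKB, localTBox, Axm.IsConceptInclusion, Assertion.IsAtomic]

theorem satAxm_localTBox_iff {ν : LocalName ↪ NC} {R : NR} {I : Interp NC NR D} :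
    (∀ τ ∈ localTBox ν R, I.SatAxm τ) ↔
      (∀ d ∈ I.conc (ν .E), ∃ e, (d, e) ∈ I.role R) ∧
      (∀ d e, (d, e) ∈ I.role R → e ∉ I.conc (ν .A)) ∧
      (∀ d ∈ I.conc (ν .B), d ∈ I.conc (ν .A)) ∧
      (∀ d ∈ I.conc (ν .C), d ∈ I.conc (ν .A)) ∧
      ∀ d ∈ I.conc (ν .B), d ∉ I.conc (ν .C) := by
  simp only [localTBox, Finset.mem_insert, Finset.mem_singleton, forall_eq_or_imp, forall_eq,
    Interp.SatAxm, Interp.basicExt, Interp.roleExt, Set.subset_def, Set.mem_ofPred_eq,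
    Set.mem_compl_iff]
  exact and_congr_right' (and_congr_left' ⟨fun h d e hd => h e ⟨d, hd⟩,
    fun h e ⟨d, hd⟩ => h d e hd⟩)

theorem mem_models_localKB {name : C ↪ D} {ν : LocalName ↪ NC} {R : NR} {a b : C}
    {I : Interp NC NR D} :
    I ∈ models name (localKB ν R a b) ↔ (∀ τ ∈ localTBox ν R, I.SatAxm τ) ∧
      name b ∈ I.conc (ν .B) ∧ name a ∈ I.conc (ν .C) := by
  simp [models, localKB, Interp.SatAssertion, Interp.basicExt]

theorem mem_models_singleton_concept {name : C ↪ D} {T : Finset (Axm NC NR)} {X : NC} {c : C}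
    {I : Interp NC NR D} :
    I ∈ models name ⟨T, {.concept (.atom X) c}⟩ ↔ (∀ τ ∈ T, I.SatAxm τ) ∧ name c ∈ I.conc X := by
  simp [models, Interp.SatAssertion, Interp.basicExt]

/-- The change of `I` that adds `E(w)` and `R(w, x)`, and takes `x` out of `A`, `B` and `C`. -/
def repair (ν : LocalName ↪ NC) (R : NR) (w x : D) (I : Interp NC NR D) : Interp NC NR D where
  conc X := {d | (X = ν .E ∧ d = w) ∨
    (d ∈ I.conc X ∧ ¬ (d = x ∧ (X = ν .A ∨ X = ν .B ∨ X = ν .C)))}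
  role P := {p | p ∈ I.role P ∨ (P = R ∧ p = (w, x))}

theorem satAxm_repair {ν : LocalName ↪ NC} {R : NR} {w x : D} {I : Interp NC NR D}
    (hI : ∀ τ ∈ localTBox ν R, I.SatAxm τ) :
    ∀ τ ∈ localTBox ν R, (repair ν R w x I).SatAxm τ := by
  rw [satAxm_localTBox_iff] at hI ⊢
  obtain ⟨hE, hR, hB, hC, hBC⟩ := hI
  simp only [repair, Set.mem_ofPred_eq, EmbeddingLike.apply_eq_iff_eq, reduceCtorEq, true_and,
    false_and, or_false, false_or, and_false, and_true, not_false_eq_true, or_true, Prod.mk.injEq]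
  refine ⟨?_, ?_, fun d hd => ⟨hB d hd.1, hd.2⟩, fun d hd => ⟨hC d hd.1, hd.2⟩,
    fun d hd hd' => hBC d hd.1 hd'.1⟩
  · rintro d (rfl | hd)
    · exact ⟨x, Or.inr ⟨rfl, rfl⟩⟩
    · obtain ⟨e, he⟩ := hE d hd
      exact ⟨e, Or.inl he⟩
  · rintro d e (he | ⟨rfl, rfl⟩) hA
    · exact hR d e he hA.1
    · exact hA.2 rfl

theorem mem_conc_E_repair (ν : LocalName ↪ NC) (R : NR) (w x : D) (I : Interp NC NR D) :
    w ∈ (repair ν R w x I).conc (ν .E) :=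
  Or.inl ⟨rfl, rfl⟩

/-- The properties of a model `J` of the TBox and `E(w)` with an `R`-edge from `w` to `x`. -/
theorem notMem_of_mem_role {ν : LocalName ↪ NC} {R : NR} {w x : D} {J : Interp NC NR D}
    (hJ : ∀ τ ∈ localTBox ν R, J.SatAxm τ) (hx : (w, x) ∈ J.role R) :
    x ∉ J.conc (ν .A) ∧ x ∉ J.conc (ν .B) ∧ x ∉ J.conc (ν .C) := by
  rw [satAxm_localTBox_iff] at hJ
  obtain ⟨-, hR, hB, hC, -⟩ := hJ
  exact ⟨hR w x hx, fun h => hR w x hx (hB x h), fun h => hR w x hx (hC x h)⟩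

theorem atomDiff_repair_subset {ν : LocalName ↪ NC} {R : NR} {w x : D} {I J : Interp NC NR D}
    (hJ : ∀ τ ∈ localTBox ν R, J.SatAxm τ) (hw : w ∈ J.conc (ν .E)) (hx : (w, x) ∈ J.role R) :
    atomDiff I (repair ν R w x I) ⊆ atomDiff I J := by
  obtain ⟨hA, hB, hC⟩ := notMem_of_mem_role hJ hx
  rintro (⟨X, d⟩ | ⟨P, d, e⟩) h
  · rw [concept_mem_atomDiff] at h ⊢
    contrapose! h
    simp only [repair, Set.mem_ofPred_eq]
    constructor
    · refine fun hd => Or.inr ⟨hd, ?_⟩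
      rintro ⟨rfl, rfl | rfl | rfl⟩
      exacts [hA (h.1 hd), hB (h.1 hd), hC (h.1 hd)]
    · rintro (⟨rfl, rfl⟩ | hd)
      exacts [h.2 hw, hd.1]
  · rw [role_mem_atomDiff] at h ⊢
    contrapose! h
    simp only [repair, Set.mem_ofPred_eq, Prod.mk.injEq]
    refine ⟨Or.inl, ?_⟩
    rintro (hd | ⟨rfl, rfl, rfl⟩)
    exacts [hd, h.2 hx]

theorem symbolDiff_repair_subset {S : Set (Symb NC NR)} {ν : LocalName ↪ NC} {R : NR} {w x : D}
    {I J : Interp NC NR D} (hsub : atomDiff I (repair ν R w x I) ⊆ atomDiff I J) :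
    symbolDiff S I (repair ν R w x I) ⊆ symbolDiff S I J := by
  rintro (X | P) ⟨hS, h⟩
  · refine ⟨hS, fun hne => h ?_⟩
    ext d
    by_contra hd
    exact (concept_mem_atomDiff.1 (hsub (concept_mem_atomDiff.2 hd))) (by rw [hne])
  · refine ⟨hS, fun hne => h ?_⟩
    ext ⟨d, e⟩
    by_contra hd
    exact (role_mem_atomDiff.1 (hsub (role_mem_atomDiff.2 hd))) (by rw [hne])

theorem diff_repair_subset {S : Set (Symb NC NR)} {y : Granularity} {ν : LocalName ↪ NC} {R : NR}
    {w x : D} {I J : Interp NC NR D} (hJ : ∀ τ ∈ localTBox ν R, J.SatAxm τ)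
    (hw : w ∈ J.conc (ν .E)) (hx : (w, x) ∈ J.role R) :
    diff S y I (repair ν R w x I) ⊆ diff S y I J := by
  have hsub := atomDiff_repair_subset (I := I) hJ hw hx
  cases y
  · exact Set.image_mono hsub
  · exact Set.image_mono (symbolDiff_repair_subset hsub)

/-- A repair alters at most one of `B` and `C`, since they are disjoint. Here `F` is the one that
may be altered. -/
theorem exists_diff_repair_subset (S : Set (Symb NC NR)) (y : Granularity) {ν : LocalName ↪ NC}
    {R : NR} (w x : D) {I : Interp NC NR D} (hI : ∀ τ ∈ localTBox ν R, I.SatAxm τ) :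
    ∃ F ∈ ({.B, .C} : Set LocalName), diff S y I (repair ν R w x I) ⊆
      match y with
      | .atomBased => Sum.inl '' {.concept (ν .E) w, .concept (ν .A) x, .concept (ν F) x,
          .role R w x}
      | .symbolBased => Sum.inr '' {.inl (ν .E), .inl (ν .A), .inl (ν F), .inr R} := by
  obtain ⟨-, -, -, -, hBC⟩ := satAxm_localTBox_iff.1 hI
  obtain ⟨F, hF, hatom⟩ : ∃ F ∈ ({.B, .C} : Set LocalName), atomDiff I (repair ν R w x I) ⊆
      {.concept (ν .E) w, .concept (ν .A) x, .concept (ν F) x, .role R w x} := by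
    have key : ∀ F G : LocalName, x ∉ I.conc (ν G) →
        (∀ X, X = ν .A ∨ X = ν .B ∨ X = ν .C → X = ν .A ∨ X = ν F ∨ X = ν G) →
        atomDiff I (repair ν R w x I) ⊆
          {.concept (ν .E) w, .concept (ν .A) x, .concept (ν F) x, .role R w x} := by
      rintro F G hG hFG (⟨X, d⟩ | ⟨P, d, e⟩) h
      · simp only [concept_mem_atomDiff, repair, Set.mem_ofPred_eq] at h
        simp only [Set.mem_insert_iff, Atom.concept.injEq, Set.mem_singleton_iff, reduceCtorEq,
          or_false]
        by_cases hd : d = x ∧ (X = ν .A ∨ X = ν .B ∨ X = ν .C)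
        · obtain ⟨rfl, hX⟩ := hd
          rcases hFG X hX with rfl | rfl | rfl
          · exact Or.inr (Or.inl ⟨rfl, rfl⟩)
          · exact Or.inr (Or.inr ⟨rfl, rfl⟩)
          · tauto
        · tauto
      · simp only [role_mem_atomDiff, repair, Set.mem_ofPred_eq, Prod.mk.injEq] at h
        simp only [Set.mem_insert_iff, reduceCtorEq, Set.mem_singleton_iff, Atom.role.injEq,
          false_or]
        tauto
    by_cases hx : x ∈ I.conc (ν .B)
    · exact ⟨.B, Or.inl rfl, key .B .C (hBC x hx) fun X => id⟩
    · exact ⟨.C, Or.inr rfl, key .C .B hx fun X => Or.imp_right Or.symm⟩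
  refine ⟨F, hF, ?_⟩
  cases y
  · exact Set.image_mono hatom
  · refine Set.image_mono ?_
    rintro (X | P) ⟨-, h⟩
    · obtain ⟨d, hd⟩ : ∃ d, ¬ (d ∈ I.conc X ↔ d ∈ (repair ν R w x I).conc X) := by
        by_contra! hall
        exact h (Set.ext hall)
      have := hatom (concept_mem_atomDiff.2 hd)
      simp only [Set.mem_insert_iff, Atom.concept.injEq, Set.mem_singleton_iff, reduceCtorEq,
        or_false, Sum.inl.injEq] at this ⊢
      tauto
    · obtain ⟨⟨d, e⟩, hd⟩ : ∃ p, ¬ (p ∈ I.role P ↔ p ∈ (repair ν R w x I).role P) := by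
        by_contra! hall
        exact h (Set.ext hall)
      have := hatom (role_mem_atomDiff.2 hd)
      simp only [Set.mem_insert_iff, reduceCtorEq, Set.mem_singleton_iff, Atom.role.injEq,
        false_or, Sum.inr.injEq] at this ⊢
      tauto

theorem encard_diff_repair_le (S : Set (Symb NC NR)) (y : Granularity) {ν : LocalName ↪ NC}
    {R : NR} (w x : D) {I : Interp NC NR D} (hI : ∀ τ ∈ localTBox ν R, I.SatAxm τ) :
    (diff S y I (repair ν R w x I)).encard ≤ (4 : ℕ) := by
  obtain ⟨F, -, hF⟩ := exists_diff_repair_subset S y w x hI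
  refine (Set.encard_le_encard hF).trans ?_
  cases y
  · rw [Sum.inl_injective.encard_image]
    exact encard_insert_four_le _ _ _ _
  · rw [Sum.inr_injective.encard_image]
    exact encard_insert_four_le _ _ _ _

theorem mem_of_mem_localExpansion {name : C ↪ D} {S : Set (Symb NC NR)} {ν : LocalName ↪ NC}
    {R : NR} {a b w : C} {y : Granularity} {z : Comparison} (hab : a ≠ b)
    (hB : .inl (ν .B) ∈ S) (hC : .inl (ν .C) ∈ S) {J : Interp NC NR D}
    (hJ : J ∈ expansion name S (localKB ν R a b) {.concept (.atom (ν .E)) w} (.loc y z)) :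
    name a ∈ J.conc (ν .A) ∨ name b ∈ J.conc (ν .A) := by
  obtain ⟨hJm, I, hI, hmin⟩ := hJ
  obtain ⟨hJT, hJw⟩ := mem_models_singleton_concept.1 hJm
  obtain ⟨hIT, hIb, hIa⟩ := mem_models_localKB.1 hI
  obtain ⟨hJE, -, hJB, hJC, -⟩ := satAxm_localTBox_iff.1 hJT
  obtain ⟨-, -, hIBA, hICA, -⟩ := satAxm_localTBox_iff.1 hIT
  obtain ⟨x, hx⟩ := hJE _ hJw
  have hfin := Set.finite_of_encard_le_coe (encard_diff_repair_le S y (name w) x hIT)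
  have heq := diff_eq_of_not_distLT hfin (diff_repair_subset hJT hJw hx)
    (hmin _ (mem_models_singleton_concept.2 ⟨satAxm_repair hIT, mem_conc_E_repair ν R _ x I⟩))
  obtain ⟨F, hF, hsub⟩ := exists_diff_repair_subset S y (name w) x hIT
  rw [heq] at hsub
  by_contra! hcon
  cases y
  · have hsub := (Set.image_subset_image_iff Sum.inl_injective).1 hsub
    -- Both `A(a)` and `A(b)` would have been taken out, but only `A(x)` is.
    have key : ∀ d ∈ I.conc (ν .A), d ∉ J.conc (ν .A) → d = x := by
      intro d hd hd'
      have := hsub (concept_mem_atomDiff.2 fun h => hd' (h.1 hd))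
      simp only [Set.mem_insert_iff, Atom.concept.injEq, Set.mem_singleton_iff, reduceCtorEq,
        EmbeddingLike.apply_eq_iff_eq, or_false, false_and, true_and, false_or] at this
      tauto
    exact hab (name.injective ((key _ (hICA _ hIa) hcon.1).trans (key _ (hIBA _ hIb) hcon.2).symm))
  · have hsub := (Set.image_subset_image_iff Sum.inr_injective).1 hsub
    -- Since `B ⊑ A` and `C ⊑ A`, both `B` and `C` would have been altered, but only `F` may be.
    have hB' : (Sum.inl (ν .B) : Symb NC NR) ∈ symbolDiff S I J :=
      ⟨hB, fun h => hcon.2 (hJB _ (h ▸ hIb))⟩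
    have hC' : (Sum.inl (ν .C) : Symb NC NR) ∈ symbolDiff S I J :=
      ⟨hC, fun h => hcon.1 (hJC _ (h ▸ hIa))⟩
    have hB' := hsub hB'
    have hC' := hsub hC'
    simp only [Set.mem_insert_iff, Sum.inl.injEq, EmbeddingLike.apply_eq_iff_eq, reduceCtorEq,
      Set.mem_singleton_iff, or_false, false_or] at hB' hC'
    exact absurd (hB'.trans hC'.symm) (by simp)

/-- The model in which `A` is the whole domain, `B` consists of `b` only, `C` is the complement of
`B`, and everything else is empty. -/
def partitionModel (NR : Type v) (ν : LocalName ↪ NC) (b : D) : Interp NC NR D where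
  conc X := {d | X = ν .A ∨ (X = ν .B ∧ d = b) ∨ (X = ν .C ∧ d ≠ b)}
  role _ := ∅

theorem satAxm_partitionModel (ν : LocalName ↪ NC) (R : NR) (b : D) :
    ∀ τ ∈ localTBox ν R, (partitionModel NR ν b).SatAxm τ := by
  rw [satAxm_localTBox_iff]
  simp [partitionModel]

theorem partitionModel_mem_models {name : C ↪ D} (ν : LocalName ↪ NC) (R : NR) {a b : C}
    (hab : a ≠ b) : partitionModel NR ν (name b) ∈ models name (localKB ν R a b) := by
  rw [mem_models_localKB]
  exact ⟨satAxm_partitionModel ν R _, by simp [partitionModel], by simp [partitionModel, hab]⟩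

theorem four_le_encard_diff_partitionModel {S : Set (Symb NC NR)} (y : Granularity)
    {ν : LocalName ↪ NC} {R : NR} {w b : D} {J : Interp NC NR D}
    (hS : ∀ X, .inl (ν X) ∈ S) (hR : .inr R ∈ S)
    (hJ : ∀ τ ∈ localTBox ν R, J.SatAxm τ) (hw : w ∈ J.conc (ν .E)) :
    (4 : ℕ) ≤ (diff S y (partitionModel NR ν b) J).encard := by
  obtain ⟨x, hx⟩ := (satAxm_localTBox_iff.1 hJ).1 w hw
  obtain ⟨hA, hB, hC⟩ := notMem_of_mem_role hJ hx
  obtain ⟨F, hF, hFx, hFJ⟩ : ∃ F ∈ ({.B, .C} : Set LocalName),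
      x ∈ (partitionModel NR ν b).conc (ν F) ∧ x ∉ J.conc (ν F) := by
    by_cases hxb : x = b
    · exact ⟨.B, Or.inl rfl, by simp [partitionModel, hxb], hB⟩
    · exact ⟨.C, Or.inr rfl, by simp [partitionModel, hxb], hC⟩
  have hEI : w ∉ (partitionModel NR ν b).conc (ν .E) := by simp [partitionModel]
  have hAI : x ∈ (partitionModel NR ν b).conc (ν .A) := by simp [partitionModel]
  have hRI : (w, x) ∉ (partitionModel NR ν b).role R := by simp [partitionModel]
  have hFE : LocalName.E ≠ F ∧ LocalName.A ≠ F := by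
    rcases hF with rfl | rfl <;> simp
  cases y
  · rw [diff, Sum.inl_injective.encard_image, Nat.cast_ofNat,
      ← encard_insert_four (p := Atom.concept (ν .E) w) (q := .concept (ν .A) x)
      (r := .concept (ν F) x) (s := .role R w x) (by simp [hFE])]
    refine Set.encard_le_encard ?_
    rintro _ (rfl | rfl | rfl | rfl)
    · simp [hEI, hw]
    · simp [hAI, hA]
    · simp [hFx, hFJ]
    · simp [hRI, hx]
  · rw [diff, Sum.inr_injective.encard_image, Nat.cast_ofNat,
      ← encard_insert_four (p := (.inl (ν .E) : Symb NC NR)) (q := .inl (ν .A))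
      (r := .inl (ν F)) (s := .inr R) (by simp [hFE])]
    refine Set.encard_le_encard ?_
    rintro _ (rfl | rfl | rfl | rfl)
    · exact ⟨hS _, fun h => hEI (h ▸ hw)⟩
    · exact ⟨hS _, fun h => hA (h ▸ hAI)⟩
    · exact ⟨hS _, fun h => hFJ (h ▸ hFx)⟩
    · exact ⟨hR, fun h => hRI (h ▸ hx)⟩

theorem repair_partitionModel_mem_expansion {name : C ↪ D} {S : Set (Symb NC NR)}
    {ν : LocalName ↪ NC} {R : NR} {a b w : C} (y : Granularity) (z : Comparison) (hab : a ≠ b)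
    (hS : ∀ X, .inl (ν X) ∈ S) (hR : .inr R ∈ S) (x : D) :
    repair ν R (name w) x (partitionModel NR ν (name b)) ∈
      expansion name S (localKB ν R a b) {.concept (.atom (ν .E)) w} (.loc y z) := by
  refine ⟨mem_models_singleton_concept.2
    ⟨satAxm_repair (satAxm_partitionModel ν R _), mem_conc_E_repair ν R _ _ _⟩, _,
    partitionModel_mem_models ν R hab, fun J' hJ' => ?_⟩
  obtain ⟨hT, hw⟩ := mem_models_singleton_concept.1 hJ'
  exact not_distLT_of_encard_le (encard_diff_repair_le S y _ x (satAxm_partitionModel ν R _))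
    (four_le_encard_diff_partitionModel y hS hR hT hw)

theorem notMem_conc_A_repair (ν : LocalName ↪ NC) (R : NR) (w x : D) (I : Interp NC NR D) :
    x ∉ (repair ν R w x I).conc (ν .A) := by
  simp [repair]

theorem inexpressible_local [Infinite NC] [Nonempty NR] [Infinite C] [Countable D] [Infinite D]
    (name : C ↪ D) (sig : KB NC NR C → Finset (Assertion NC NR C) → Set (Symb NC NR))
    (hsig : ∀ K N, symbolsIn K N ⊆ sig K N) (y : Granularity) (z : Comparison) :
    InexpressibleABoxExpansionFrom name sig KB.IsCore (.loc y z) := by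
  obtain ⟨ν⟩ := nonempty_localName_embedding NC
  obtain ⟨R⟩ := ‹Nonempty NR›
  obtain ⟨a, b, hab⟩ := exists_pair_ne C
  set S := sig (localKB ν R a b) {.concept (.atom (ν .E)) a}
  have hS : ∀ X, .inl (ν X) ∈ S := by
    intro X
    apply hsig
    left
    cases X <;> simp [localKB, localTBox, Axm.symbols, Basic.symb, Role.symb]
  have hR : .inr R ∈ S := by
    apply hsig
    left
    simp [localKB, localTBox, Axm.symbols, Basic.symb, Role.symb]
  have hmem := repair_partitionModel_mem_expansion (name := name) (w := a) y z hab hS hR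
  have hor : ∀ J ∈ expansion name S (localKB ν R a b) {.concept (.atom (ν .E)) a} (.loc y z),
      J.SatAssertion name (.concept (.atom (ν .A)) a) ∨
        J.SatAssertion name (.concept (.atom (ν .A)) b) :=
    fun J hJ => mem_of_mem_localExpansion hab (hS _) (hS _) hJ
  have ha := (⟨_, hmem (name a), notMem_conc_A_repair ν R _ _ _⟩ :
    ∃ J ∈ expansion name S (localKB ν R a b) {.concept (.atom (ν .E)) a} (.loc y z),
      ¬ J.SatAssertion name (.concept (.atom (ν .A)) a))
  have hb := (⟨_, hmem (name b), notMem_conc_A_repair ν R _ _ _⟩ :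
    ∃ J ∈ expansion name S (localKB ν R a b) {.concept (.atom (ν .E)) a} (.loc y z),
      ¬ J.SatAssertion name (.concept (.atom (ν .A)) b))
  exact ⟨localKB ν R a b, .concept (.atom (ν .E)) a, isCore_localKB ν R a b, trivial,
    ⟨_, partitionModel_mem_models ν R hab⟩, ⟨_, (hmem (name a)).1⟩,
    not_exists_models_eq name hor ha hb, ν .A, a, b, hor, ha, hb⟩

/-! ### Global semantics -/

open Classical in
/-- The TBox `B ⊑ ∃R`, `∃R⁻ ⊑ ¬A`, `(funct R)` with the ABox `R(w, c)`, `B(w)`, `A(a)`, `A(b)`. -/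
noncomputable def globalKB (A B : NC) (R : NR) (a b c w : C) : KB NC NR C where
  tbox := {.conceptIncl (.atom B) (.ex (.atom R)), .conceptDisj (.ex (.inv R)) (.atom A),
    .funct (.atom R)}
  abox := {.role R w c, .concept (.atom B) w, .concept (.atom A) a, .concept (.atom A) b}

theorem isF_globalKB (A B : NC) (R : NR) (a b c w : C) : (globalKB A B R a b c w).IsF := by
  simp [KB.IsF, globalKB, Axm.IsConceptInclusion, Axm.IsFunctionality, Assertion.IsAtomic]

theorem satAxm_globalKB_iff {A B : NC} {R : NR} {a b c w : C} {I : Interp NC NR D} :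
    (∀ τ ∈ (globalKB A B R a b c w).tbox, I.SatAxm τ) ↔
      (∀ d ∈ I.conc B, ∃ e, (d, e) ∈ I.role R) ∧
      (∀ d e, (d, e) ∈ I.role R → e ∉ I.conc A) ∧
      ∀ d e e', (d, e) ∈ I.role R → (d, e') ∈ I.role R → e = e' := by
  simp only [globalKB, Finset.mem_insert, Finset.mem_singleton, forall_eq_or_imp, forall_eq,
    Interp.SatAxm, Interp.basicExt, Interp.roleExt, Set.subset_def, Set.mem_ofPred_eq,
    Set.mem_compl_iff]
  exact and_congr_right' (and_congr_left' ⟨fun h d e hd => h e ⟨d, hd⟩,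
    fun h e ⟨d, hd⟩ => h d e hd⟩)

theorem mem_models_globalKB {name : C ↪ D} {A B : NC} {R : NR} {a b c w : C}
    {I : Interp NC NR D} :
    I ∈ models name (globalKB A B R a b c w) ↔
      (∀ τ ∈ (globalKB A B R a b c w).tbox, I.SatAxm τ) ∧
      (name w, name c) ∈ I.role R ∧ name w ∈ I.conc B ∧ name a ∈ I.conc A ∧
        name b ∈ I.conc A := by
  simp only [models, Set.mem_ofPred_eq]
  refine and_congr_right' ?_
  simp [globalKB, Interp.SatAssertion, Interp.basicExt]

/-- The interpretation with the given extensions of `A`, `B` and `R`, all other names being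
empty. -/
def interpOf (A B : NC) (R : NR) (sA sB : Set D) (sR : Set (D × D)) : Interp NC NR D where
  conc X := {d | (X = A ∧ d ∈ sA) ∨ (X = B ∧ d ∈ sB)}
  role P := {p | P = R ∧ p ∈ sR}

/-- The least model of `globalKB`. -/
def globalBase (A B : NC) (R : NR) (a b c w : D) : Interp NC NR D :=
  interpOf A B R {a, b} {w} {(w, c)}

/-- The least model of `globalKB`, with `x` in place of `c` as the successor of `w`, with `A(c)`
added, and with `x` taken out of `A`. -/
def globalRepair (A B : NC) (R : NR) (a b c w x : D) : Interp NC NR D :=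
  interpOf A B R ({a, b, c} \ {x}) {w} {(w, x)}

theorem globalBase_mem_models {name : C ↪ D} {A B : NC} (hAB : A ≠ B) (R : NR) {a b c w : C}
    (hca : c ≠ a) (hcb : c ≠ b) :
    globalBase A B R (name a) (name b) (name c) (name w) ∈
      models name (globalKB A B R a b c w) := by
  rw [mem_models_globalKB, satAxm_globalKB_iff]
  simp +contextual [globalBase, interpOf, hAB, hAB.symm, hca, hcb]

theorem globalRepair_mem_models {name : C ↪ D} {A B : NC} (hAB : A ≠ B) (R : NR) {a b c w : C}
    {x : D} (hx : x ≠ name c) :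
    globalRepair A B R (name a) (name b) (name c) (name w) x ∈
      models name ⟨(globalKB A B R a b c w).tbox, {.concept (.atom A) c}⟩ := by
  rw [mem_models_singleton_concept, satAxm_globalKB_iff]
  simp +contextual [globalRepair, interpOf, hAB, hAB.symm, hx.symm]

theorem atomDiff_globalRepair_subset (A B : NC) (R : NR) (a b c w x : D) :
    atomDiff (globalBase A B R a b c w) (globalRepair A B R a b c w x) ⊆
      {t | t = .concept A c ∨ t = .role R w c ∨ t = .role R w x ∨
        (t = .concept A x ∧ (x = a ∨ x = b))} := by
  rintro (⟨X, d⟩ | ⟨P, d, e⟩) h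
  · simp only [concept_mem_atomDiff, globalBase, globalRepair, interpOf, Set.mem_ofPred_eq,
      Set.mem_insert_iff, Set.mem_singleton_iff, Set.mem_sdiff] at h
    simp only [Set.mem_ofPred_eq, Atom.concept.injEq, reduceCtorEq, false_or]
    grind
  · simp only [role_mem_atomDiff, globalBase, globalRepair, interpOf, Set.mem_ofPred_eq,
      Set.mem_singleton_iff, Prod.mk.injEq] at h
    simp only [Set.mem_ofPred_eq, Atom.role.injEq, reduceCtorEq, false_or, false_and, or_false]
    tauto

/-- If `w` is taken out of `B`, then no other changes than the loss of `R(w, c)` and the new `A(c)`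
are called for. -/
theorem exists_globalModel_atomDiff_subset {name : C ↪ D} {A B : NC} (hAB : A ≠ B) (R : NR)
    (a b c w : C) :
    ∃ J ∈ models name ⟨(globalKB A B R a b c w).tbox, {.concept (.atom A) c}⟩,
      atomDiff (globalBase A B R (name a) (name b) (name c) (name w)) J ⊆
        {.concept A (name c), .role R (name w) (name c), .concept B (name w)} := by
  refine ⟨interpOf A B R {name a, name b, name c} ∅ ∅, ?_, ?_⟩
  · rw [mem_models_singleton_concept, satAxm_globalKB_iff]
    simp [interpOf, hAB.symm]
  · rintro (⟨X, d⟩ | ⟨P, d, e⟩) h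
    · simp only [concept_mem_atomDiff, globalBase, interpOf, Set.mem_ofPred_eq,
        Set.mem_insert_iff, Set.mem_singleton_iff, Set.mem_empty_iff_false] at h
      simp only [Set.mem_insert_iff, Set.mem_singleton_iff, Atom.concept.injEq, reduceCtorEq,
        false_or]
      tauto
    · simp only [role_mem_atomDiff, globalBase, interpOf, Set.mem_ofPred_eq,
        Set.mem_singleton_iff, Prod.mk.injEq, Set.mem_empty_iff_false] at h
      simp only [Set.mem_insert_iff, Set.mem_singleton_iff, Atom.role.injEq, reduceCtorEq,
        false_or, or_false]
      tauto

/-- The changes that are forced on a pair of models if `w` remains in `B`. -/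
theorem exists_role_mem_atomDiff {name : C ↪ D} {A B : NC} {R : NR} {a b c w : C}
    {I J : Interp NC NR D} (hI : I ∈ models name (globalKB A B R a b c w))
    (hJ : J ∈ models name ⟨(globalKB A B R a b c w).tbox, {.concept (.atom A) c}⟩)
    (hw : name w ∈ J.conc B) :
    ∃ y, y ≠ name c ∧ y ∉ J.conc A ∧ .role R (name w) y ∈ atomDiff I J := by
  obtain ⟨hIT, hIR, -⟩ := mem_models_globalKB.1 hI
  obtain ⟨-, -, hIf⟩ := satAxm_globalKB_iff.1 hIT
  obtain ⟨hJT, hJc⟩ := mem_models_singleton_concept.1 hJ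
  obtain ⟨hJB, hJR, -⟩ := satAxm_globalKB_iff.1 hJT
  obtain ⟨y, hy⟩ := hJB _ hw
  have hyA := hJR _ _ hy
  have hyc : y ≠ name c := fun h => hyA (h ▸ hJc)
  exact ⟨y, hyc, hyA, role_mem_atomDiff.2 fun h => hyc (hIf _ _ _ (h.2 hy) hIR)⟩

/-- The changes that are forced on every pair of models. -/
theorem mem_atomDiff_of_mem_models {name : C ↪ D} {A B : NC} {R : NR} {a b c w : C}
    {I J : Interp NC NR D} (hI : I ∈ models name (globalKB A B R a b c w))
    (hJ : J ∈ models name ⟨(globalKB A B R a b c w).tbox, {.concept (.atom A) c}⟩) :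
    .concept A (name c) ∈ atomDiff I J ∧ .role R (name w) (name c) ∈ atomDiff I J := by
  obtain ⟨hIT, hIR, -⟩ := mem_models_globalKB.1 hI
  obtain ⟨hJT, hJc⟩ := mem_models_singleton_concept.1 hJ
  exact ⟨concept_mem_atomDiff.2 fun h => (satAxm_globalKB_iff.1 hIT).2.1 _ _ hIR (h.2 hJc),
    role_mem_atomDiff.2 fun h => (satAxm_globalKB_iff.1 hJT).2.1 _ _ (h.1 hIR) hJc⟩

theorem mem_of_mem_globalExpansion {name : C ↪ D} {S : Set (Symb NC NR)} {A B : NC} (hAB : A ≠ B)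
    {R : NR} {a b c w : C} (hab : a ≠ b) (hca : c ≠ a) (hcb : c ≠ b) {J : Interp NC NR D}
    (hJ : J ∈ expansion name S (globalKB A B R a b c w) {.concept (.atom A) c}
      (.glob .atomBased .inclusion)) :
    name a ∈ J.conc A ∨ name b ∈ J.conc A := by
  obtain ⟨hJm, I, hI, hmin⟩ := hJ
  obtain ⟨-, -, hIB, hIa, hIb⟩ := mem_models_globalKB.1 hI
  by_contra! hcon
  have ha : .concept A (name a) ∈ atomDiff I J := concept_mem_atomDiff.2 fun h => hcon.1 (h.1 hIa)
  have hb : .concept A (name b) ∈ atomDiff I J := concept_mem_atomDiff.2 fun h => hcon.2 (h.1 hIb)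
  obtain ⟨hAc, hRc⟩ := mem_atomDiff_of_mem_models hI hJm
  have hbase := globalBase_mem_models (name := name) hAB R (w := w) hca hcb
  by_cases hw : name w ∈ J.conc B
  · -- Giving `w` the same new successor `y`, but otherwise starting from the least model, takes
    -- only `y` out of `A`.
    obtain ⟨y, hyc, hyA, hyR⟩ := exists_role_mem_atomDiff hI hJm hw
    have hsub := atomDiff_globalRepair_subset A B R (name a) (name b) (name c) (name w) y
    have hle : atomDiff (globalBase A B R (name a) (name b) (name c) (name w))
        (globalRepair A B R (name a) (name b) (name c) (name w) y) ⊆ atomDiff I J := by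
      refine hsub.trans ?_
      rintro _ (rfl | rfl | rfl | ⟨rfl, rfl | rfl⟩)
      exacts [hAc, hRc, hyR, ha, hb]
    have hge : atomDiff I J ⊆ _ :=
      (not_not.1 fun h => hmin _ hbase _ (globalRepair_mem_models hAB R hyc) ⟨hle, h⟩ :)
    have ha' := hsub (hge ha)
    have hb' := hsub (hge hb)
    simp only [Set.mem_ofPred_eq, Atom.concept.injEq, EmbeddingLike.apply_eq_iff_eq, hca.symm,
      hcb.symm, and_false, reduceCtorEq, true_and, false_or] at ha' hb'
    exact hab (name.injective (ha'.1.trans hb'.1.symm))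
  · obtain ⟨J', hJ', hsub⟩ := exists_globalModel_atomDiff_subset (name := name) hAB R a b c w
    have hle : atomDiff (globalBase A B R (name a) (name b) (name c) (name w)) J' ⊆
        atomDiff I J := by
      refine hsub.trans ?_
      rintro _ (rfl | rfl | rfl)
      exacts [hAc, hRc, concept_mem_atomDiff.2 fun h => hw (h.1 hIB)]
    have hge : atomDiff I J ⊆ _ :=
      (not_not.1 fun h => hmin _ hbase _ hJ' ⟨hle, h⟩ :)
    have ha' := hsub (hge ha)
    simp [hca.symm, hAB] at ha'

theorem globalRepair_mem_expansion {name : C ↪ D} {S : Set (Symb NC NR)} {A B : NC}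
    (hAB : A ≠ B) {R : NR} {a b c w x : C} (hca : c ≠ a) (hcb : c ≠ b) (hx : x = a ∨ x = b) :
    globalRepair A B R (name a) (name b) (name c) (name w) (name x) ∈
      expansion name S (globalKB A B R a b c w) {.concept (.atom A) c}
        (.glob .atomBased .inclusion) := by
  have hxc : name x ≠ name c := by
    rw [name.injective.ne_iff]
    rcases hx with rfl | rfl
    exacts [hca.symm, hcb.symm]
  refine ⟨globalRepair_mem_models hAB R hxc, _, globalBase_mem_models hAB R hca hcb, ?_⟩
  rintro I hI J hJ ⟨hle, hge⟩
  have hsub := atomDiff_globalRepair_subset A B R (name a) (name b) (name c) (name w) (name x)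
  obtain ⟨hAc, hRc⟩ := mem_atomDiff_of_mem_models hI hJ
  obtain ⟨-, -, hIB, hIa, hIb⟩ := mem_models_globalKB.1 hI
  have hw : name w ∈ J.conc B := by
    by_contra hw
    have := hsub (hle (concept_mem_atomDiff.2 fun h => hw (h.1 hIB)))
    simp [hAB.symm] at this
  obtain ⟨y, hyc, hyA, hyR⟩ := exists_role_mem_atomDiff hI hJ hw
  obtain rfl : y = name x := by
    have := hsub (hle hyR)
    simpa [hyc] using this
  refine hge (hsub.trans ?_)
  rintro _ (rfl | rfl | rfl | ⟨rfl, -⟩)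
  · exact hAc
  · exact hRc
  · exact hyR
  · refine concept_mem_atomDiff.2 fun h => hyA (h.1 ?_)
    rcases hx with rfl | rfl
    exacts [hIa, hIb]

theorem notMem_conc_A_globalRepair {A B : NC} (hAB : A ≠ B) (R : NR) (a b c w x : D) :
    x ∉ (globalRepair A B R a b c w x).conc A := by
  simp [globalRepair, interpOf, hAB]

theorem inexpressible_global [Infinite NC] [Nonempty NR] [Infinite C] [Countable D] [Infinite D]
    (name : C ↪ D) (sig : KB NC NR C → Finset (Assertion NC NR C) → Set (Symb NC NR)) :
    InexpressibleABoxExpansionFrom name sig KB.IsF (.glob .atomBased .inclusion) := by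
  obtain ⟨A, B, hAB⟩ := exists_pair_ne NC
  obtain ⟨R⟩ := ‹Nonempty NR›
  obtain ⟨a, b, hab⟩ := exists_pair_ne C
  obtain ⟨c, hc⟩ := (Set.toFinite {a, b}).exists_notMem
  obtain ⟨hca, hcb⟩ : c ≠ a ∧ c ≠ b := by simpa using hc
  set K := globalKB A B R a b c c
  set M := expansion name (sig K {.concept (.atom A) c}) K {.concept (.atom A) c}
    (.glob .atomBased .inclusion)
  have hor : ∀ J ∈ M, J.SatAssertion name (.concept (.atom A) a) ∨
      J.SatAssertion name (.concept (.atom A) b) :=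
    fun J hJ => mem_of_mem_globalExpansion hAB hab hca hcb hJ
  have ha : ∃ J ∈ M, ¬ J.SatAssertion name (.concept (.atom A) a) :=
    ⟨_, globalRepair_mem_expansion hAB hca hcb (Or.inl rfl),
      notMem_conc_A_globalRepair hAB _ _ _ _ _ _⟩
  have hb : ∃ J ∈ M, ¬ J.SatAssertion name (.concept (.atom A) b) :=
    ⟨_, globalRepair_mem_expansion hAB hca hcb (Or.inr rfl),
      notMem_conc_A_globalRepair hAB _ _ _ _ _ _⟩
  exact ⟨K, .concept (.atom A) c, isF_globalKB A B R a b c c, trivial,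
    ⟨_, globalBase_mem_models hAB R hca hcb⟩, ha.imp fun J hJ => hJ.1.1,
    not_exists_models_eq name hor ha hb, A, a, b, hor, ha, hb⟩

end DLLite

theorem mainTheorem4 {NC NR C D : Type*}
    [Countable NC] [Infinite NC] [Countable NR] [Infinite NR]
    [Infinite C] [Countable D] [Infinite D] (name : C ↪ D)
    (sig : DLLite.KB NC NR C → Finset (DLLite.Assertion NC NR C) → Set (DLLite.Symb NC NR))
    (hsig : ∀ K N, DLLite.symbolsIn K N ⊆ sig K N) :
    (∀ y z, ¬ DLLite.ClosedUnderABoxExpansion name sig (.loc y z)) ∧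
    (¬ DLLite.ClosedUnderABoxExpansion name sig (.glob .atomBased .inclusion)) ∧
    (∀ y z, DLLite.InexpressibleABoxExpansionFrom name sig DLLite.KB.IsCore (.loc y z)) ∧
    DLLite.InexpressibleABoxExpansionFrom name sig DLLite.KB.IsF
      (.glob .atomBased .inclusion) := by
  have hloc := DLLite.inexpressible_local name sig hsig
  have hglob := DLLite.inexpressible_global name sig
  exact ⟨fun y z => (hloc y z).not_closed fun K hK => hK.isF.isFR,
    hglob.not_closed fun K hK => hK.isFR, hloc, hglob⟩
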